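/- Let $k\ge 0$ and $n\ge 2k+1$ be integers. All graphs are finite and simple. For a graph $G$, let $\lambda(G)$ denote its spectral radius, i.e. the largest absolute value of an eigenvalue of its adjacency matrix. Let $M_{k+1}$ be the graph consisting of $k+1$ pairwise disjoint edges; a graph is $M_{k+1}$-free if it contains no subgraph isomorphic to $M_{k+1}$. Write $G_1\cup G_2$ for the disjoint union of two graphs, $G_1\vee G_2$ for their join (the disjoint union together with all edges between $G_1$ and $G_2$), $K_m$ for the complete graph on $m$ vertices and $mK_1$ for the edgeless graph on $m$ vertices. Let $G$ be an $n$-vertex $M_{k+1}$-free graph whose spectral radius is maximum among all $n$-vertex $M_{k+1}$-free graphs. Then $$\lambda(G)=\max\Bigl(\{\lambda(K_{2k+1})\}\cup\bigl\{\lambda\bigl(K_s\vee((n-2k+s-1)K_1\cup K_{2k-2s+1})\bigr): 1\le s\le k\bigr\}\Bigr).$$ -/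

import Mathlib

namespace SpectralMatching

/-- The spectral radius of a finite graph: the largest absolute value of an eigenvalue of its
(real symmetric) adjacency matrix. The spectrum of a matrix is finite, so the supremum in
Mathlib's `spectralRadius` is a maximum of finite numbers. -/
noncomputable def lam {V : Type*} [Fintype V] (G : SimpleGraph V) : ℝ :=
  open Classical in (spectralRadius ℝ (G.adjMatrix ℝ)).toReal

/-- The graph `M_m` consisting of `m` pairwise disjoint edges (the edge with index `i` joins
`(i, 0)` and `(i, 1)`). -/
def matchingGraph (m : ℕ) : SimpleGraph (Fin m × Fin 2) where
  Adj x y := x.1 = y.1 ∧ x.2 ≠ y.2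
  symm := ⟨fun _ _ h => ⟨h.1.symm, h.2.symm⟩⟩
  loopless := ⟨fun _ h => h.2 rfl⟩

/-- The join `G ∨ H`: the disjoint union of `G` and `H` together with all edges between them. -/
def join {V W : Type*} (G : SimpleGraph V) (H : SimpleGraph W) : SimpleGraph (V ⊕ W) :=
  (G ⊕g H) ⊔ completeBipartiteGraph V W

/-- The complete graph `K_m`. -/
abbrev K (m : ℕ) : SimpleGraph (Fin m) := ⊤

/-- The edgeless graph `m K_1`. -/
abbrev isolated (m : ℕ) : SimpleGraph (Fin m) := ⊥

/-- The graph `K_s ∨ ((n - 2k + s - 1) K_1 ∪ K_{2k - 2s + 1})`. It is used only for `2k + 1 ≤ n`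
and `1 ≤ s ≤ k`, where none of the subtractions truncates. -/
def extremalGraph (n k s : ℕ) :
    SimpleGraph (Fin s ⊕ (Fin (n - 2 * k + s - 1) ⊕ Fin (2 * k - 2 * s + 1))) :=
  join (K s) (isolated (n - 2 * k + s - 1) ⊕g K (2 * k - 2 * s + 1))

end SpectralMatching

namespace SpectralMatching

open Finset

/-! By Tutte-Berge, an `n`-vertex graph without `k + 1` disjoint edges has a set `S` of `s ≤ k`
vertices whose removal leaves at least `n + s - 2k` components
(`exists_separator_of_matchingGraph_free`). For a fixed nonnegative vector, keeping one vertex of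
each component but the heaviest and merging all the rest into one clique does not decrease the
quadratic form (`exists_sum_sameClass_le`). Joining `S` to everything then gives a subgraph of the
extremal graph for `s`, so Rayleigh quotients bound `lam G`. Conversely, the extremal graphs are
competitors on `n` vertices, and `s = 0` gives `λ(K_{2k+1})`. -/

/-! ### Spectral radius and Rayleigh quotients -/

open Classical in
/-- The quadratic form of the adjacency matrix of `G`, i.e. twice the sum of `x u * x v` over the
edges `uv`. -/
noncomputable def adjForm {V : Type*} [Fintype V] (G : SimpleGraph V) (x : V → ℝ) : ℝ :=
  ∑ u, ∑ v, if G.Adj u v then x u * x v else 0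

open Classical in
lemma dotProduct_adjMatrix_mulVec {V : Type*} [Fintype V] (G : SimpleGraph V) (x : V → ℝ) :
    x ⬝ᵥ (G.adjMatrix ℝ).mulVec x = adjForm G x := by
  simp only [adjForm, dotProduct, Matrix.mulVec, mul_sum, SimpleGraph.adjMatrix_apply]
  refine sum_congr rfl fun u _ => sum_congr rfl fun v _ => ?_
  split_ifs <;> simp

open Classical in
lemma isHermitian_adjMatrix {V : Type*} (G : SimpleGraph V) :
    (G.adjMatrix ℝ).IsHermitian := by
  rw [Matrix.IsHermitian, Matrix.conjTranspose_eq_transpose_of_trivial]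
  exact G.transpose_adjMatrix

open Classical in
lemma exists_lam_eq_abs_eigenvalue {V : Type*} [Fintype V] [Nonempty V] (G : SimpleGraph V) :
    ∃ i, lam G = |(isHermitian_adjMatrix G).eigenvalues i| ∧
      ∀ j, |(isHermitian_adjMatrix G).eigenvalues j| ≤
        |(isHermitian_adjMatrix G).eigenvalues i| := by
  obtain ⟨i, hi⟩ := Finite.exists_max fun i => |(isHermitian_adjMatrix G).eigenvalues i|
  refine ⟨i, ?_, hi⟩
  have key : spectralRadius ℝ (G.adjMatrix ℝ) =
      (‖(isHermitian_adjMatrix G).eigenvalues i‖₊ : ENNReal) := by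
    rw [spectralRadius, (isHermitian_adjMatrix G).spectrum_real_eq_range_eigenvalues, iSup_range]
    refine le_antisymm (iSup_le fun j => ?_) (le_iSup
      (fun j => (‖(isHermitian_adjMatrix G).eigenvalues j‖₊ : ENNReal)) i)
    rw [ENNReal.coe_le_coe, ← NNReal.coe_le_coe]
    simpa using hi j
  unfold lam
  rw [key]
  simp

lemma lam_nonneg {V : Type*} [Fintype V] (G : SimpleGraph V) : 0 ≤ lam G :=
  ENNReal.toReal_nonneg

/-- No eigenvalue exceeds `lam G`, so `lam G • 1 - A` is positive semidefinite. -/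
lemma adjForm_le {V : Type*} [Fintype V] [Nonempty V] (G : SimpleGraph V) (x : V → ℝ) :
    adjForm G x ≤ lam G * ∑ v, x v ^ 2 := by
  classical
  obtain ⟨i, hi, hmax⟩ := exists_lam_eq_abs_eigenvalue G
  have hpsd : (algebraMap ℝ (Matrix V V ℝ) (lam G) - G.adjMatrix ℝ).PosSemidef := by
    rw [Matrix.posSemidef_iff_isHermitian_and_spectrum_nonneg]
    refine ⟨?_, ?_⟩
    · refine Matrix.IsHermitian.sub ?_ (by convert isHermitian_adjMatrix G)
      rw [Matrix.algebraMap_eq_diagonal]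
      exact Matrix.isHermitian_diagonal _
    · rw [← spectrum.singleton_sub_eq]
      rintro a ⟨b, hb, c, hc, rfl⟩
      rw [Set.mem_singleton_iff] at hb
      subst hb
      have h2 := (isHermitian_adjMatrix G).spectrum_real_eq_range_eigenvalues
      have hc' : c ∈ Set.range (isHermitian_adjMatrix G).eigenvalues := by
        rw [← h2]; convert hc
      obtain ⟨j, rfl⟩ := hc'
      have := hmax j
      rw [← hi] at this
      simpa using (le_abs_self _).trans this
  have h := hpsd.dotProduct_mulVec_nonneg x
  rw [Matrix.sub_mulVec, dotProduct_sub, Matrix.algebraMap_eq_diagonal] at h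
  have h1 : x ⬝ᵥ (G.adjMatrix ℝ).mulVec x = adjForm G x := by
    convert dotProduct_adjMatrix_mulVec G x
  have h3 : x ⬝ᵥ (Matrix.diagonal ((algebraMap ℝ (V → ℝ)) (lam G))).mulVec x =
      lam G * ∑ v, x v ^ 2 := by
    simp only [dotProduct, Matrix.mulVec_diagonal, mul_sum, Pi.algebraMap_apply,
      Algebra.algebraMap_self, RingHom.id_apply]
    exact sum_congr rfl fun v _ => by ring
  have h4 : star x = x := by ext; simp
  rw [h4, h1, h3] at h
  linarith

/-- Entrywise absolute values of an eigenvector for an eigenvalue of largest modulus work, by the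
triangle inequality, whatever the eigenvalue's sign. -/
lemma exists_nonneg_lam_mul_le_adjForm {V : Type*} [Fintype V] [Nonempty V]
    (G : SimpleGraph V) :
    ∃ x : V → ℝ, (∀ v, 0 ≤ x v) ∧ 0 < ∑ v, x v ^ 2 ∧ lam G * ∑ v, x v ^ 2 ≤ adjForm G x := by
  classical
  obtain ⟨i, hi, -⟩ := exists_lam_eq_abs_eigenvalue G
  set hA := isHermitian_adjMatrix G
  set z : V → ℝ := (hA.eigenvectorBasis i).ofLp
  have hnorm : ∑ v, z v ^ 2 = 1 := by
    have := hA.eigenvectorBasis.orthonormal.1 i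
    rw [EuclideanSpace.norm_eq, Real.sqrt_eq_one] at this
    simpa using this
  have hev : adjForm G z = hA.eigenvalues i := by
    rw [← dotProduct_adjMatrix_mulVec]
    have := hA.mulVec_eigenvectorBasis i
    rw [this, dotProduct_smul]
    have h1 : z ⬝ᵥ z = 1 := by
      rw [← hnorm, dotProduct]
      exact sum_congr rfl fun v _ => (sq _).symm
    change _ • (z ⬝ᵥ z) = _
    rw [h1]; simp
  refine ⟨fun v => |z v|, fun v => abs_nonneg _, ?_, ?_⟩
  · simp [hnorm]
  · simp only [sq_abs, hnorm, mul_one, hi, ← hev]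
    refine (abs_sum_le_sum_abs _ _).trans (sum_le_sum fun u _ =>
      (abs_sum_le_sum_abs _ _).trans (sum_le_sum fun v _ => ?_))
    split_ifs <;> simp [abs_mul]

/-- The spectral radius does not decrease if some Rayleigh-type comparison holds for all
nonnegative vectors. -/
lemma lam_le_of_forall_adjForm_le {V W : Type*} [Fintype V] [Fintype W] [Nonempty V] [Nonempty W]
    {G : SimpleGraph V} {H : SimpleGraph W}
    (h : ∀ x : V → ℝ, (∀ v, 0 ≤ x v) → ∃ y : W → ℝ,
      adjForm G x ≤ adjForm H y ∧ ∑ w, y w ^ 2 ≤ ∑ v, x v ^ 2) :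
    lam G ≤ lam H := by
  obtain ⟨x, hx0, hpos, hx⟩ := exists_nonneg_lam_mul_le_adjForm G
  obtain ⟨y, hy, hyx⟩ := h x hx0
  have h1 := adjForm_le H y
  have h2 := mul_le_mul_of_nonneg_left hyx (lam_nonneg H)
  exact le_of_mul_le_mul_right (hx.trans (hy.trans (h1.trans h2))) hpos

lemma adjForm_mono {V : Type*} [Fintype V] {G H : SimpleGraph V} (h : G ≤ H) {x : V → ℝ}
    (hx : ∀ v, 0 ≤ x v) : adjForm G x ≤ adjForm H x := by
  classical
  refine sum_le_sum fun u _ => sum_le_sum fun v _ => ?_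
  have := mul_nonneg (hx u) (hx v)
  by_cases h1 : G.Adj u v
  · rw [if_pos h1, if_pos (h h1)]
  · rw [if_neg h1]; split_ifs <;> simp [this]

/-- A nonnegative vector can be transported along a containment of graphs without decreasing the
quadratic form. -/
lemma exists_adjForm_le_of_isContained {V W : Type*} [Fintype V] [Fintype W]
    {G : SimpleGraph V} {H : SimpleGraph W} (h : G.IsContained H) {x : V → ℝ}
    (hx : ∀ v, 0 ≤ x v) :
    ∃ y : W → ℝ, adjForm G x ≤ adjForm H y ∧ ∑ w, y w ^ 2 = ∑ v, x v ^ 2 := by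
  classical
  obtain ⟨f⟩ := h
  have hf := f.injective'
  -- Extension by zero off the image of the copy.
  set y : W → ℝ := fun w => if h : ∃ v, f.toHom v = w then x h.choose else 0
  have hy : ∀ v, y (f.toHom v) = x v := fun v => by
    have h : ∃ v', f.toHom v' = f.toHom v := ⟨v, rfl⟩
    simp only [y, dif_pos h]
    rw [hf h.choose_spec]
  have hy0 : ∀ w, w ∉ Set.range f.toHom → y w = 0 := fun w hw => dif_neg hw
  have key : ∀ g : W → ℝ, (∀ w, w ∉ Set.range f.toHom → g w = 0) →
      ∑ v, g (f.toHom v) = ∑ w, g w := fun g hg =>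
    Finset.sum_of_injOn f.toHom hf.injOn (by simp) (fun w _ hw => hg w (by simpa using hw))
      (fun _ _ => rfl)
  refine ⟨y, ?_, ?_⟩
  · simp only [adjForm]
    rw [← key _ (fun w hw => by simp [hy0 w hw])]
    refine sum_le_sum fun u _ => ?_
    rw [← key _ (fun w hw => by simp [hy0 w hw])]
    refine sum_le_sum fun v _ => ?_
    rw [hy, hy]
    have := mul_nonneg (hx u) (hx v)
    by_cases h1 : G.Adj u v
    · rw [if_pos h1, if_pos (f.toHom.map_adj h1)]
    · rw [if_neg h1]; split_ifs <;> simp [this]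
  · rw [← key _ (fun w hw => by simp [hy0 w hw])]
    simp only [hy]

/-- The spectral radius is monotone with respect to containment of graphs. -/
lemma lam_le_of_isContained {V W : Type*} [Fintype V] [Fintype W] [Nonempty V]
    {G : SimpleGraph V} {H : SimpleGraph W} (h : G.IsContained H) : lam G ≤ lam H := by
  have : Nonempty W := ‹Nonempty V›.map h.some.toHom
  refine lam_le_of_forall_adjForm_le fun x hx => ?_
  obtain ⟨y, hy, hyx⟩ := exists_adjForm_le_of_isContained h hx
  exact ⟨y, hy, hyx.le⟩

/-! ### Matchings and separators -/

/-- An involution along edges without fixed points on a set of at least `2 * m` vertices yields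
`m` pairwise disjoint edges. -/
lemma matchingGraph_isContained_of_involution {V : Type*} [Fintype V] {G : SimpleGraph V} {m : ℕ}
    (A : Finset V) (p : V → V) (hp : ∀ a ∈ A, p a ∈ A ∧ p (p a) = a ∧ G.Adj a (p a))
    (hA : 2 * m ≤ #A) : (matchingGraph m).IsContained G := by
  classical
  let e := Fintype.equivFin V
  -- An arbitrary linear order selects one end of each pair.
  set B := A.filter fun a => e a < e (p a) with hB
  have hsub : A ⊆ B ∪ B.image p := fun a ha => by
    obtain ⟨h1, h2, h3⟩ := hp a ha
    rcases lt_or_gt_of_ne (e.injective.ne h3.ne) with h | h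
    · exact mem_union_left _ (mem_filter.2 ⟨ha, h⟩)
    · exact mem_union_right _ (mem_image.2 ⟨p a, mem_filter.2 ⟨h1, by rwa [h2]⟩, h2⟩)
  have hcard : m ≤ #B := by
    have h1 := card_le_card hsub
    have h2 := card_union_le B (B.image p)
    have h3 := card_image_le (s := B) (f := p)
    omega
  obtain ⟨b⟩ : Nonempty (Fin m ↪ B) :=
    Function.Embedding.nonempty_of_card_le (by simpa using hcard)
  have hb : ∀ i, (b i : V) ∈ A ∧ e (b i) < e (p (b i)) := fun i => mem_filter.1 (b i).2
  have hpb : ∀ i, p (p (b i)) = b i := fun i => (hp _ (hb i).1).2.1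
  have hcross : ∀ i j, (b i : V) ≠ p (b j) := fun i j h => by
    have h1 := (hb i).2
    rw [h, hpb] at h1
    exact lt_asymm h1 (hb j).2
  refine ⟨⟨⟨fun x => if x.2 = 0 then b x.1 else p (b x.1), ?_⟩, ?_⟩⟩
  · rintro ⟨i, a⟩ ⟨j, c⟩ ⟨h1, h2⟩
    obtain rfl : i = j := h1
    have := (hp _ (hb i).1).2.2
    fin_cases a <;> fin_cases c <;> simp_all [SimpleGraph.adj_comm]
  · rintro ⟨i, a⟩ ⟨j, c⟩ h
    change (if a = 0 then (b i : V) else p (b i)) = if c = 0 then (b j : V) else p (b j) at h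
    have hinj : ∀ i j, (b i : V) = b j → i = j := fun i j h => b.injective (Subtype.ext h)
    fin_cases a <;> fin_cases c
    · simpa using hinj i j (by simpa using h)
    · exact absurd (by simpa using h) (hcross i j)
    · exact absurd (by simpa using h.symm) (hcross j i)
    · have h' : p (b i) = p (b j) := by simpa using h
      simpa using hinj i j (by rw [← hpb i, h', hpb])

/-- A vertex weighting in which both ends of every edge have total weight at least `2` bounds the
size of a matching. -/
lemma matchingGraph_free_of_weight {V : Type*} [Fintype V] {G : SimpleGraph V} {m : ℕ}
    (w : V → ℕ) (hw : ∀ u v, G.Adj u v → 2 ≤ w u + w v) (hsum : ∑ v, w v < 2 * m) :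
    (matchingGraph m).Free G := by
  classical
  rintro ⟨f⟩
  have h1 : ∑ x, w (f.toHom x) ≤ ∑ v, w v := by
    rw [← sum_image (f := w) f.injective'.injOn]
    exact sum_le_sum_of_subset (subset_univ _)
  rw [Fintype.sum_prod_type] at h1
  have h2 : ∑ _i : Fin m, 2 ≤ ∑ i, ∑ j, w (f.toHom (i, j)) := sum_le_sum fun i _ => by
    rw [Fin.sum_univ_two]
    exact hw _ _ (f.toHom.map_adj ⟨rfl, by simp⟩)
  have h3 : ∑ _i : Fin m, 2 = 2 * m := by simp [mul_comm]
  omega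

/-- If `G` has no matching with `k + 1` edges, then joining `G` with few vertices does not create
a perfect matching. -/
lemma not_isPerfectMatching_join {V : Type*} [Fintype V] {G : SimpleGraph V} {k d : ℕ}
    (hfree : (matchingGraph (k + 1)).Free G) (hd : 2 * k + 2 + d ≤ Fintype.card V)
    (M : (join G (K d)).Subgraph) : ¬ M.IsPerfectMatching := by
  classical
  rintro ⟨hM, hspan⟩
  refine hfree ?_
  set A : Finset V := univ.filter fun v => ∃ w, M.Adj (.inl v) (.inl w) with hA
  set p : V → V := fun v => if h : ∃ w, M.Adj (.inl v) (.inl w) then h.choose else v with hp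
  have hpadj : ∀ v ∈ A, M.Adj (.inl v) (.inl (p v)) := fun v hv => by
    have h : ∃ w, M.Adj (.inl v) (.inl w) := (mem_filter.1 hv).2
    simp only [hp, dif_pos h]
    exact h.choose_spec
  have hpA : ∀ v ∈ A, p v ∈ A := fun v hv => mem_filter.2 ⟨mem_univ _, v, (hpadj v hv).symm⟩
  refine matchingGraph_isContained_of_involution A p (fun a ha => ⟨hpA a ha, ?_, ?_⟩) ?_
  · exact Sum.inl_injective
      (hM.eq_of_adj_left (hpadj _ (hpA a ha)) (hpadj a ha).symm)
  · simpa [join] using (hpadj a ha).adj_sub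
  · have hex : ∀ v, v ∉ A → ∃ i, M.Adj (.inl v) (.inr i) := fun v hv => by
      obtain ⟨w, hw, -⟩ := hM (hspan (.inl v))
      rcases w with w | i
      · exact absurd (mem_filter.2 ⟨mem_univ _, w, hw⟩) hv
      · exact ⟨i, hw⟩
    -- Vertices not matched within `V` have distinct partners among the `d` new ones.
    have hc : #Aᶜ ≤ d := by
      choose g hg using fun v : (Aᶜ : Finset V) => hex v (mem_compl.1 v.2)
      have hinj : Function.Injective g := fun v w h => by
        have h1 := hg v
        rw [h] at h1
        exact Subtype.ext (Sum.inl_injective (hM.eq_of_adj_right h1 (hg w)))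
      have h1 := Fintype.card_le_of_injective g hinj
      rwa [Fintype.card_coe, Fintype.card_fin] at h1
    rw [card_compl] at hc
    omega

/-- The Tutte-Berge formula, in the form of a separating set leaving many components. -/
lemma exists_separator_of_matchingGraph_free {V : Type*} [Fintype V] {G : SimpleGraph V} {k : ℕ}
    (hfree : (matchingGraph (k + 1)).Free G) (hk : 2 * k + 1 ≤ Fintype.card V) :
    ∃ (S : Finset V) (m : ℕ) (f : V → Fin (m + 1)),
      (∀ u v, u ∉ S → v ∉ S → G.Adj u v → f u = f v) ∧ (∀ c, ∃ v, v ∉ S ∧ f v = c) ∧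
      Fintype.card V + #S ≤ m + 1 + 2 * k := by
  classical
  have : Nonempty V := Fintype.card_pos_iff.1 (by omega)
  rcases hk.eq_or_lt with h | h
  · exact ⟨∅, 0, fun _ => 0, by simp, fun c => ⟨Classical.arbitrary V, by simp, by omega⟩,
      by simp; omega⟩
  -- The largest `d` for which the join still has no perfect matching; `card V + d` is then even.
  set d := Fintype.card V - 2 * k - 2 with hd
  have hnot : ¬ ∃ M : (join G (K d)).Subgraph, M.IsPerfectMatching := fun ⟨M, hM⟩ =>
    not_isPerfectMatching_join hfree (by omega) M hM
  rw [SimpleGraph.tutte] at hnot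
  push Not at hnot
  obtain ⟨u, hu⟩ := hnot
  rw [SimpleGraph.IsTutteViolator] at hu
  set D := ((⊤ : (join G (K d)).Subgraph).deleteVerts u) with hD
  have hDmem : ∀ v, v ∈ D.verts ↔ v ∉ u := fun v => by simp [hD]
  have hDadj : ∀ a b : D.verts, (join G (K d)).Adj a b → D.coe.Adj a b := fun a b hab => by
    simp only [SimpleGraph.Subgraph.coe_adj, hD, SimpleGraph.Subgraph.deleteVerts_adj]
    exact ⟨trivial, (hDmem _).1 a.2, trivial, (hDmem _).1 b.2, hab⟩
  have hcardD : Nat.card D.verts + u.ncard = Fintype.card V + d := by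
    have h1 : D.verts = uᶜ := by ext v; simp [hDmem]
    rw [h1, Nat.card_coe_set_eq, add_comm, Set.ncard_add_ncard_compl]
    simp
  have hpar := SimpleGraph.odd_ncard_oddComponents (G := D.coe)
  -- The number of odd components has the parity of `u.ncard`, so exceeding it means exceeding it by
  -- 2.
  have hq : u.ncard + 2 ≤ D.coe.oddComponents.ncard := by
    by_contra hlt
    have hq1 : D.coe.oddComponents.ncard = u.ncard + 1 := by omega
    rw [hq1, Nat.odd_iff, Nat.odd_iff] at hpar
    omega
  have hle : D.coe.oddComponents.ncard ≤ Nat.card D.coe.ConnectedComponent := by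
    rw [← Set.ncard_univ]
    exact Set.ncard_le_ncard (Set.subset_univ _)
  -- A surviving new vertex is adjacent to all other survivors, leaving one component where two are
  -- needed.
  have hinr : ∀ i, Sum.inr i ∈ u := fun i => by
    by_contra hi
    have hone : Nat.card D.coe.ConnectedComponent ≤ 1 := by
      rw [Finite.card_le_one_iff_subsingleton]
      have key : ∀ c : D.coe.ConnectedComponent,
          c = D.coe.connectedComponentMk ⟨.inr i, (hDmem _).2 hi⟩ := by
        refine SimpleGraph.ConnectedComponent.ind fun v => ?_
        rw [SimpleGraph.ConnectedComponent.eq]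
        by_cases hv : v = ⟨.inr i, (hDmem _).2 hi⟩
        · rw [hv]
        · refine (hDadj _ _ ?_).reachable
          have hne : (v : V ⊕ Fin d) ≠ .inr i := fun h => hv (Subtype.ext h)
          rcases hv' : (v : V ⊕ Fin d) with a | j
          · simp [join]
          · rw [hv'] at hne
            have : j ≠ i := fun h => hne (by rw [h])
            simp [join, this]
      exact ⟨fun a b => (key a).trans (key b).symm⟩
    omega
  set S : Finset V := univ.filter fun v => Sum.inl v ∈ u with hS
  have hSmem : ∀ v, v ∈ S ↔ Sum.inl v ∈ u := fun v => by simp [hS]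
  have hucard : u.ncard = #S + d := by
    have : u = ↑(S.disjSum (univ : Finset (Fin d))) := by
      ext v
      rcases v with v | i
      · simp [hSmem]
      · simp [hinr]
    rw [this, Set.ncard_coe_finset, card_disjSum]
    simp
  obtain ⟨m, hm⟩ : ∃ m, Nat.card D.coe.ConnectedComponent = m + 1 :=
    Nat.exists_eq_succ_of_ne_zero (by omega)
  let e : D.coe.ConnectedComponent ≃ Fin (m + 1) := Finite.equivFinOfCardEq hm
  -- The value 0 on `S` is a dummy.
  refine ⟨S, m, fun v => if hv : Sum.inl v ∈ u then 0 else
    e (D.coe.connectedComponentMk ⟨.inl v, (hDmem _).2 hv⟩), ?_, ?_, ?_⟩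
  · intro a b ha hb hab
    rw [hSmem] at ha hb
    simp only [dif_neg ha, dif_neg hb]
    congr 1
    rw [SimpleGraph.ConnectedComponent.eq]
    exact (hDadj _ _ (by simpa [join] using hab)).reachable
  · intro c
    obtain ⟨c, rfl⟩ := e.surjective c
    obtain ⟨⟨v, hv⟩, rfl⟩ := c.exists_rep
    rcases v with v | i
    · have hv' := (hDmem _).1 hv
      refine ⟨v, fun h => hv' ((hSmem v).1 h), ?_⟩
      simp only [dif_neg hv']
      rfl
    · exact absurd (hinr i) ((hDmem _).1 hv)
  · omega

/-! ### Merging classes into the heaviest one -/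

/-- Given a partition of `T` into classes, all vertices outside a system of representatives can be
moved into the class of largest weight without decreasing the total weight of the pairs within
classes. -/
lemma exists_sum_sameClass_le {V C : Type*} [DecidableEq V] [DecidableEq C] [Fintype C]
    [Nonempty C] (T : Finset V) (f : V → C) (hf : ∀ c, ∃ v, v ∈ T ∧ f v = c) (x : V → ℝ)
    (hx : ∀ v, 0 ≤ x v) :
    ∃ W ⊆ T, #W + Fintype.card C = #T + 1 ∧
      ∑ u ∈ T, ∑ v ∈ T, (if u ≠ v ∧ f u = f v then x u * x v else 0) ≤
        ∑ u ∈ T, ∑ v ∈ T, if u ≠ v ∧ u ∈ W ∧ v ∈ W then x u * x v else 0 := by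
  set X : C → ℝ := fun c => ∑ v ∈ T with f v = c, x v with hX
  obtain ⟨i, hi⟩ := Finite.exists_max X
  choose r hrT hrf using hf
  have hrinj : Function.Injective r := Function.LeftInverse.injective (g := f) hrf
  set R := (univ.erase i).image r with hR
  have hRT : R ⊆ T := fun v hv => by
    obtain ⟨c, -, rfl⟩ := mem_image.1 hv
    exact hrT c
  have hRcard : #R + 1 = Fintype.card C := by
    rw [hR, card_image_of_injective _ hrinj, card_erase_add_one (mem_univ _), card_univ]
  have hsumR : ∀ g : V → ℝ, ∑ v ∈ R, g v = ∑ c ∈ univ.erase i, g (r c) := fun g =>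
    sum_image hrinj.injOn
  refine ⟨T \ R, sdiff_subset, ?_, ?_⟩
  · have := card_sdiff_add_card_eq_card hRT
    omega
  have hdiag : ∀ (P : V → V → Prop) [∀ u v, Decidable (P u v)] (u : V), u ∈ T →
      ∑ v ∈ T, (if u ≠ v ∧ P u v then x u * x v else 0) =
        ∑ v ∈ T, (if P u v then x u * x v else 0) - if P u u then x u ^ 2 else 0 := by
    intro P _ u hu
    rw [← add_sum_erase T _ hu, ← add_sum_erase T (fun v => if P u v then x u * x v else 0) hu]
    have : ∑ v ∈ T.erase u, (if u ≠ v ∧ P u v then x u * x v else 0) =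
        ∑ v ∈ T.erase u, (if P u v then x u * x v else 0) :=
      sum_congr rfl fun v hv => by simp [(ne_of_mem_erase hv).symm]
    rw [this]
    simp [sq]
  have hL : ∑ u ∈ T, ∑ v ∈ T, (if u ≠ v ∧ f u = f v then x u * x v else 0) =
      ∑ c, X c ^ 2 - ∑ u ∈ T, x u ^ 2 := by
    rw [sum_congr rfl (hdiag fun u v => f u = f v), sum_sub_distrib]
    simp only [if_true]
    congr 1
    rw [← sum_fiberwise T f]
    refine sum_congr rfl fun c _ => ?_
    rw [sq, hX, sum_mul_sum]
    refine sum_congr rfl fun u hu => ?_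
    rw [(mem_filter.1 hu).2, sum_filter]
    exact sum_congr rfl fun v _ => by simp [eq_comm]
  have hRsum : ∑ u ∈ T, ∑ v ∈ T, (if u ≠ v ∧ u ∈ T \ R ∧ v ∈ T \ R then x u * x v else 0) =
      (∑ u ∈ T \ R, x u) ^ 2 - ∑ u ∈ T \ R, x u ^ 2 := by
    rw [sum_congr rfl (hdiag fun u v => u ∈ T \ R ∧ v ∈ T \ R), sum_sub_distrib]
    have hTW : T ∩ (T \ R) = T \ R := inter_eq_right.2 sdiff_subset
    congr 1
    · simp only [ite_and, sum_ite_irrel, sum_const_zero]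
      rw [sum_ite_mem, hTW, sq, sum_mul_sum]
      refine sum_congr rfl fun u _ => ?_
      rw [sum_ite_mem, hTW]
    · simp only [and_self]
      rw [sum_ite_mem, hTW]
  have hWsq := sum_sdiff (f := fun u => x u ^ 2) hRT
  have hW := sum_sdiff (f := x) hRT
  rw [hsumR] at hWsq hW
  have hTX : ∑ u ∈ T, x u = X i + ∑ c ∈ univ.erase i, X c := by
    rw [add_sum_erase _ _ (mem_univ i), ← sum_fiberwise T f]
  have hrX : ∀ c, x (r c) ≤ X c := fun c =>
    single_le_sum (f := x) (fun v _ => hx v) (mem_filter.2 ⟨hrT c, hrf c⟩)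
  -- Factor the difference of squares; both `X c` and `x (r c)` are at most `X i`.
  have hy : ∑ c ∈ univ.erase i, (X c ^ 2 - x (r c) ^ 2) ≤
      2 * X i * ∑ c ∈ univ.erase i, (X c - x (r c)) := by
    rw [mul_sum]
    refine sum_le_sum fun c _ => ?_
    nlinarith [hrX c, hi c, hx (r c)]
  rw [hL, hRsum, ← add_sum_erase _ _ (mem_univ i)]
  rw [sum_sub_distrib, sum_sub_distrib] at hy
  have hWeq : ∑ u ∈ T \ R, x u =
      X i + (∑ c ∈ univ.erase i, X c - ∑ c ∈ univ.erase i, x (r c)) := by linarith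
  rw [hWeq]
  nlinarith [sq_nonneg (∑ c ∈ univ.erase i, X c - ∑ c ∈ univ.erase i, x (r c))]

/-! ### Comparison with the extremal graphs -/

/-- The graph in which `S` is joined to everything, `S` and `W` are cliques, and there are no other
edges. -/
def splitClique {V : Type*} (S W : Finset V) : SimpleGraph V where
  Adj u v := u ≠ v ∧ (u ∈ S ∨ v ∈ S ∨ u ∈ W ∧ v ∈ W)
  symm := ⟨fun _ _ h => ⟨h.1.symm, by tauto⟩⟩
  loopless := ⟨fun _ h => h.1 rfl⟩

lemma splitClique_mono {V : Type*} {S W W' : Finset V} (h : W ⊆ W') :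
    splitClique S W ≤ splitClique S W' :=
  fun _ _ huv => ⟨huv.1, huv.2.imp_right fun h1 => h1.imp_right fun h2 => ⟨h h2.1, h h2.2⟩⟩

lemma splitClique_isContained_extremalGraph {V : Type*} [Fintype V] {k : ℕ} {S W : Finset V}
    (hk : 2 * k + 1 ≤ Fintype.card V) (hS : #S ≤ k) (hSW : Disjoint S W)
    (hW : #W = 2 * k - 2 * #S + 1) :
    (splitClique S W).IsContained (extremalGraph (Fintype.card V) k #S) := by
  classical
  have hR : #(S ∪ W)ᶜ = Fintype.card V - 2 * k + #S - 1 := by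
    rw [card_compl, card_union_of_disjoint hSW]
    omega
  have eS := S.equivFin
  have eW := W.equivFinOfCardEq hW
  have eR := (S ∪ W)ᶜ.equivFinOfCardEq hR
  let φ : V → Fin #S ⊕ (Fin (Fintype.card V - 2 * k + #S - 1) ⊕ Fin (2 * k - 2 * #S + 1)) :=
    fun v => if h : v ∈ S then .inl (eS ⟨v, h⟩) else if h' : v ∈ W then .inr (.inr (eW ⟨v, h'⟩))
      else .inr (.inl (eR ⟨v, by simp [h, h']⟩))
  have hφ : Function.Injective φ := fun u v huv => by
    simp only [φ] at huv
    split_ifs at huv <;> simp at huv <;> exact huv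
  refine ⟨⟨⟨φ, fun {u v} huv => ?_⟩, hφ⟩⟩
  obtain ⟨hne, h⟩ := huv
  have hne' := hφ.ne hne
  rw [extremalGraph]
  simp only [φ] at hne' ⊢
  split_ifs at hne' ⊢ <;> simp_all [join]

/-- A graph on at least `2 * k + 1` vertices without matchings of size `k + 1` has spectral radius
at most that of one of the extremal graphs. -/
lemma exists_lam_le_lam_extremalGraph {V : Type*} [Fintype V] {G : SimpleGraph V} {k : ℕ}
    (hfree : (matchingGraph (k + 1)).Free G) (hk : 2 * k + 1 ≤ Fintype.card V) :
    ∃ s ≤ k, lam G ≤ lam (extremalGraph (Fintype.card V) k s) := by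
  classical
  obtain ⟨S, m, f, hfadj, hfsurj, hcard⟩ := exists_separator_of_matchingGraph_free hfree hk
  have : Nonempty V := Fintype.card_pos_iff.1 (by omega)
  have hcompl := card_add_card_compl S
  have hW : ∀ x : V → ℝ, (∀ v, 0 ≤ x v) → ∃ W ⊆ Sᶜ, #W + (m + 1) = #Sᶜ + 1 ∧
      ∑ u ∈ Sᶜ, ∑ v ∈ Sᶜ, (if u ≠ v ∧ f u = f v then x u * x v else 0) ≤
        ∑ u ∈ Sᶜ, ∑ v ∈ Sᶜ, if u ≠ v ∧ u ∈ W ∧ v ∈ W then x u * x v else 0 := fun x hx => by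
    simpa using exists_sum_sameClass_le Sᶜ f (by simpa using hfsurj) x hx
  -- Each class has a vertex outside `S`, so `m + 1 ≤ card V - #S`.
  have hSk : #S ≤ k := by
    have : m + 1 ≤ #Sᶜ := by
      have := card_le_card_of_surjOn (s := Sᶜ) (t := (univ : Finset (Fin (m + 1)))) f
        fun c _ => by simpa using hfsurj c
      simpa using this
    omega
  refine ⟨#S, hSk, ?_⟩
  have : Nonempty (Fin #S ⊕
      (Fin (Fintype.card V - 2 * k + #S - 1) ⊕ Fin (2 * k - 2 * #S + 1))) := ⟨.inr (.inr 0)⟩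
  refine lam_le_of_forall_adjForm_le fun x hx => ?_
  -- `W` depends on `x`, but its size does not, so one extremal graph serves all `x`.
  obtain ⟨W, hWS, hWcard, hWsum⟩ := hW x hx
  obtain ⟨W', hWW', hW'S, hW'card⟩ := exists_subsuperset_card_eq hWS
    (n := 2 * k - 2 * #S + 1) (by omega) (by omega)
  obtain ⟨y, hy, hyx⟩ := exists_adjForm_le_of_isContained
    (splitClique_isContained_extremalGraph hk hSk
      (disjoint_left.2 fun v hv hv' => mem_compl.1 (hW'S hv') hv) hW'card) hx
  refine ⟨y, le_trans ?_ hy, hyx.le⟩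
  refine le_trans ?_ (adjForm_mono (splitClique_mono hWW') hx)
  have hrestrict : ∀ g : V → V → ℝ, ∑ u ∈ Sᶜ, ∑ v ∈ Sᶜ, g u v =
      ∑ u, ∑ v, if u ∉ S ∧ v ∉ S then g u v else 0 := fun g => by
    have hmem : ∀ g : V → ℝ, ∑ v ∈ Sᶜ, g v = ∑ v, if v ∉ S then g v else 0 := fun g => by
      rw [← sum_filter]
      exact sum_congr (by ext; simp) fun _ _ => rfl
    rw [hmem]
    refine sum_congr rfl fun u _ => ?_
    rw [hmem]
    by_cases hu : u ∈ S <;> simp [hu]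
  rw [hrestrict, hrestrict, ← sub_nonneg, ← sum_sub_distrib] at hWsum
  rw [← sub_nonneg]
  refine hWsum.trans ?_
  simp only [adjForm]
  rw [← sum_sub_distrib]
  refine sum_le_sum fun u _ => ?_
  rw [← sum_sub_distrib, ← sum_sub_distrib]
  refine sum_le_sum fun v _ => ?_
  have h0 := mul_nonneg (hx u) (hx v)
  by_cases huv : u ∉ S ∧ v ∉ S
  · rw [if_pos huv, if_pos huv]
    refine sub_le_sub (le_of_eq ?_) ?_
    · simp [splitClique, huv.1, huv.2]
    · by_cases hG : G.Adj u v
      · rw [if_pos hG, if_pos ⟨hG.ne, hfadj u v huv.1 huv.2 hG⟩]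
      · rw [if_neg hG]
        split_ifs <;> simp [h0]
  -- Pairs meeting `S` are all edges of `splitClique S W`.
  · rw [if_neg huv, if_neg huv, sub_zero, sub_nonneg]
    by_cases hG : G.Adj u v
    · have : (splitClique S W).Adj u v := ⟨hG.ne, by tauto⟩
      rw [if_pos hG, if_pos this]
    · rw [if_neg hG]
      split_ifs <;> simp [h0]

/-- Weights 2 on `K_s`, 1 on the other clique and 0 elsewhere total `2k + 1`. -/
lemma matchingGraph_free_extremalGraph {n k s : ℕ} (hs : s ≤ k) :
    (matchingGraph (k + 1)).Free (extremalGraph n k s) := by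
  refine matchingGraph_free_of_weight (Sum.elim (fun _ => 2) (Sum.elim (fun _ => 0) fun _ => 1))
    ?_ ?_
  · rintro (u | u | u) (v | v | v) <;> simp [extremalGraph, join]
  · simp
    omega

lemma lam_extremalGraph_zero (n k : ℕ) :
    lam (extremalGraph n k 0) = lam (K (2 * k + 1)) := by
  classical
  have : Nonempty (Fin 0 ⊕ (Fin (n - 2 * k + 0 - 1) ⊕ Fin (2 * k - 2 * 0 + 1))) :=
    ⟨.inr (.inr 0)⟩
  refine le_antisymm ?_ (lam_le_of_isContained
    ⟨⟨⟨fun v => .inr (.inr v), by simp [extremalGraph, join]⟩, fun u v h =>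
      Sum.inr_injective (Sum.inr_injective h)⟩⟩)
  refine lam_le_of_forall_adjForm_le fun x _ => ⟨fun v => x (.inr (.inr v)), le_of_eq ?_, ?_⟩
  · simp [adjForm, extremalGraph, join]
    exact sum_congr rfl fun _ _ => sum_congr rfl fun _ _ => by congr
  · simpa using sum_nonneg fun i _ => sq_nonneg (x (.inr (.inl i)))

/-- The extremal graph has exactly `card V` vertices, so a relabelled copy competes with `G`. -/
lemma lam_extremalGraph_le {V : Type*} [Fintype V] {G : SimpleGraph V} {k s : ℕ} (hs : s ≤ k)
    (hk : 2 * k + 1 ≤ Fintype.card V)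
    (hmax : ∀ H : SimpleGraph V, (matchingGraph (k + 1)).Free H → lam H ≤ lam G) :
    lam (extremalGraph (Fintype.card V) k s) ≤ lam G := by
  classical
  obtain ⟨e⟩ : Nonempty (Fin s ⊕ (Fin (Fintype.card V - 2 * k + s - 1) ⊕
      Fin (2 * k - 2 * s + 1)) ≃ V) := Fintype.card_eq.1 (by simp; omega)
  have : Nonempty (Fin s ⊕ (Fin (Fintype.card V - 2 * k + s - 1) ⊕
      Fin (2 * k - 2 * s + 1))) := ⟨.inr (.inr 0)⟩
  let φ := SimpleGraph.Iso.map e (extremalGraph (Fintype.card V) k s)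
  exact (lam_le_of_isContained ⟨φ.toCopy⟩).trans (hmax _
    ((SimpleGraph.free_congr_right φ).1 (matchingGraph_free_extremalGraph hs)))

end SpectralMatching

theorem theorem4p12 {V : Type*} [Fintype V] (n k : ℕ) (hn : 2 * k + 1 ≤ n)
    (hV : Fintype.card V = n) (G : SimpleGraph V)
    (hfree : (SpectralMatching.matchingGraph (k + 1)).Free G)
    (hmax : ∀ H : SimpleGraph V, (SpectralMatching.matchingGraph (k + 1)).Free H →
      SpectralMatching.lam H ≤ SpectralMatching.lam G) :
    IsGreatest
      ({SpectralMatching.lam (SpectralMatching.K (2 * k + 1))} ∪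
        {x : ℝ | ∃ s : ℕ, 1 ≤ s ∧ s ≤ k ∧
          x = SpectralMatching.lam (SpectralMatching.extremalGraph n k s)})
      (SpectralMatching.lam G) := by
  subst hV
  refine ⟨?_, ?_⟩
  · obtain ⟨s, hs, hle⟩ := SpectralMatching.exists_lam_le_lam_extremalGraph hfree hn
    have heq := le_antisymm hle (SpectralMatching.lam_extremalGraph_le hs hn hmax)
    rcases s.eq_zero_or_pos with rfl | hpos
    · exact Or.inl (heq.trans (SpectralMatching.lam_extremalGraph_zero _ k))
    · exact Or.inr ⟨s, hpos, hs, heq⟩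
  · rintro x (rfl | ⟨s, -, hs, rfl⟩)
    · rw [← SpectralMatching.lam_extremalGraph_zero (Fintype.card V) k]
      exact SpectralMatching.lam_extremalGraph_le k.zero_le hn hmax
    · exact SpectralMatching.lam_extremalGraph_le hs hn hmax
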